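/- Let $S$ be a group acting on a set $X$ by $(a,x)\mapsto\phi(a,x)$, let $e$ be its unit, and let $\alpha:S\times X\to\mathbb C\setminus\{0\}$ satisfy $$\alpha(ab,x)\overline{\alpha(ab,y)}=\alpha(a,\phi(b,x))\,\overline{\alpha(a,\phi(b,y))}\,\alpha(b,x)\,\overline{\alpha(b,y)}\quad\text{and}\quad \alpha(e,x)=1$$ for all $a,b\in S$ and $x,y\in X$. Then $\sigma(a,b)=\alpha(a,\phi(b,x))^{-1}\alpha(b,x)^{-1}\alpha(ab,x)$ does not depend on $x\in X$. A (complex) Krein space is a space with an indefinite inner product $[\xi,\eta]=\langle J\xi,\eta\rangle$, where $\langle\cdot,\cdot\rangle$ is a Hilbert space inner product and $J=J^*=J^{-1}$ is bounded; $\mathcal L(\cdot,\cdot)$ denotes the bounded linear operators and $T^\sharp$ the adjoint of $T$ with respect to the indefinite inner products. The negative signature of an inner product space is the maximal dimension of its negative subspaces (those with $[v,v]<0$ for every nonzero vector $v$), and a Pontryagin space is a Krein space whose negative signature is finite. Let $\mathcal H$ be a Krein space and let $K:X\times X\to\mathcal L(\mathcal H)$ be a hermitian kernel, i.e. $K(x,y)=K(y,x)^\sharp$,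 which is $\phi$-invariant, i.e. $$K(x,\phi(a,y))=\overline{\alpha(a,\phi(a^{-1},x))}\,\alpha(a,y)\,K(\phi(a^{-1},x),y)\qquad(a\in S,\ x,y\in X).$$ Assume that $K$ has a finite number of negative squares, i.e. the inner product $[f,g]_K=\sum_{x,y\in X}[K(x,y)f(y),g(x)]$ on the finitely supported functions $f,g:X\to\mathcal H$ has finite negative signature. A Kolmogorov decomposition of $K$ is a pair $(V;\mathcal K)$ of a Krein space $\mathcal K$ and a family $V(x)\in\mathcal L(\mathcal H,\mathcal K)$, $x\in X$, such that $K(x,y)=V(x)^\sharp V(y)$ for all $x,y\in X$ and the linear span of $\bigcup_{x}V(x)\mathcal H$ is dense in $\mathcal K$. It is projectively invariant if there are operators $U(a)\in\mathcal L(\mathcal K)$, $a\in S$, such that $U(a)U(b)=\sigma(a,b)U(ab)$ and $V(\phi(a,x))=\alpha(a,x)U(a)V(x)$ for all $a,b\in S$, $x\in X$. Then $K$ has a projectively invariant Kolmogorov decomposition $(V;\mathcal K)$ in which $\mathcal K$ is a Pontryagin space. Moreover, it is unique up to unitary equivalence: if $(V_1;\mathcal K_1)$ and $(V_2;\mathcal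 K_2)$ are projectively invariant Kolmogorov decompositions of $K$, then there is $\Phi\in\mathcal L(\mathcal K_1,\mathcal K_2)$ with $\Phi^\sharp\Phi=I$ and $\Phi\Phi^\sharp=I$ such that $V_2(x)=\Phi V_1(x)$ for all $x\in X$. -/

import Mathlib

universe u v w w₁ w₂

/-- A (complex) Krein space: a space with an indefinite inner product of the form
`[ξ, η] = ⟨J ξ, η⟩`, where `⟨·,·⟩` is a Hilbert space inner product and `J` is a symmetry
(`J* = J⁻¹ = J`).  The Hilbert space structure fixes the strong topology. -/
class KreinSpace (H : Type*) [NormedAddCommGroup H] [InnerProductSpace ℂ H]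
    [CompleteSpace H] where
  /-- the fundamental symmetry -/
  symm : H →L[ℂ] H
  adjoint_symm : ContinuousLinearMap.adjoint symm = symm
  symm_comp_symm : symm ∘L symm = ContinuousLinearMap.id ℂ H

namespace KreinSpace

section Basic

variable {H : Type*} [NormedAddCommGroup H] [InnerProductSpace ℂ H] [CompleteSpace H]
  [KreinSpace H]
variable {G : Type*} [NormedAddCommGroup G] [InnerProductSpace ℂ G] [CompleteSpace G]
  [KreinSpace G]

/-- The indefinite inner product `[ξ, η] = ⟨J ξ, η⟩`, linear in `ξ` and conjugate linear in `η`
(Mathlib's `inner` is conjugate linear in its first argument). -/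
noncomputable def indef (ξ η : H) : ℂ := inner ℂ η (symm ξ)

/-- The adjoint `T♯` of a bounded operator with respect to the indefinite inner products. -/
noncomputable def sharp (T : H →L[ℂ] G) : G →L[ℂ] H :=
  (symm : H →L[ℂ] H) ∘L ContinuousLinearMap.adjoint T ∘L (symm : G →L[ℂ] G)

/-- The characteristic property of `T♯`. -/
theorem indef_sharp (T : H →L[ℂ] G) (ξ : H) (η : G) :
    indef (T ξ) η = indef ξ (sharp T η) := by
  have hH : ∀ x y : H, inner ℂ (symm x) y = inner ℂ x (symm y) := fun x y => by
    rw [← ContinuousLinearMap.adjoint_inner_right, adjoint_symm]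
  have hG : ∀ x y : G, inner ℂ (symm x) y = inner ℂ x (symm y) := fun x y => by
    rw [← ContinuousLinearMap.adjoint_inner_right, adjoint_symm]
  have h2 : ∀ x : H, symm (symm x) = x := fun x => by
    simpa using DFunLike.congr_fun (symm_comp_symm (H := H)) x
  simp [indef, sharp, hH, h2, ContinuousLinearMap.adjoint_inner_left, hG]

/-- A bounded operator between Krein spaces is unitary if `U♯ U = I` and `U U♯ = I`. -/
def IsUnitary (U : H →L[ℂ] G) : Prop :=
  sharp U ∘L U = ContinuousLinearMap.id ℂ H ∧ U ∘L sharp U = ContinuousLinearMap.id ℂ G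

end Basic

/-- The negative signature of an inner product `q` on a complex vector space: the maximal dimension
of its negative subspaces (`[v, v] < 0` for all nonzero `v` in the subspace), with the value `⊤`
if these dimensions are unbounded. -/
noncomputable def negSignature {E : Type*} [AddCommGroup E] [Module ℂ E] (q : E → E → ℂ) : ℕ∞ :=
  ⨆ N : {N : Submodule ℂ E // ∀ v ∈ N, v ≠ 0 → (q v v).re < 0},
    Cardinal.toENat (Module.rank ℂ N.1)

/-- A Pontryagin space: a Krein space with finite negative signature. -/
def IsPontryagin (G : Type*) [NormedAddCommGroup G] [InnerProductSpace ℂ G] [CompleteSpace G]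
    [KreinSpace G] : Prop :=
  negSignature (indef : G → G → ℂ) < ⊤

section Kernels

variable {X : Type*}
variable {H : Type*} [NormedAddCommGroup H] [InnerProductSpace ℂ H] [CompleteSpace H]
  [KreinSpace H]
variable {G : Type*} [NormedAddCommGroup G] [InnerProductSpace ℂ G] [CompleteSpace G]
  [KreinSpace G]

/-- Hermitian kernels: `K(x, y) = K(y, x)♯`. -/
def IsHermitianKernel (K : X → X → H →L[ℂ] H) : Prop :=
  ∀ x y, K x y = sharp (K y x)

/-- The inner product `[f, g]_K = ∑_{x, y} [K(x, y) f(y), g(x)]` on finitely supported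
functions. -/
noncomputable def kernelInner (K : X → X → H →L[ℂ] H) (f g : X →₀ H) : ℂ :=
  g.sum fun x gx => f.sum fun y fy => indef (K x y fy) gx

/-- The kernel has a finite number of negative squares. -/
def HasFinitelyManyNegativeSquares (K : X → X → H →L[ℂ] H) : Prop :=
  negSignature (kernelInner K) < ⊤

/-- `(V; G)` is a Kolmogorov decomposition of `K`: `K(x, y) = V(x)♯ V(y)`, and the linear span of
the ranges of the `V(x)` is dense. -/
def IsKolmogorovDecomposition (K : X → X → H →L[ℂ] H) (V : X → H →L[ℂ] G) : Prop :=
  (∀ x y, K x y = sharp (V x) ∘L V y) ∧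
    (⨆ x, LinearMap.range (V x).toLinearMap).topologicalClosure = ⊤

end Kernels

section Actions

variable {S : Type*} [Group S] {X : Type*} [MulAction S X]

/-- The conditions on the function `α` that accompanies an action of a group `S` (with the
involution `a ↦ a⁻¹`) on `X`. -/
structure IsMultiplier (α : S → X → ℂ) : Prop where
  ne_zero : ∀ a x, α a x ≠ 0
  mul_conj : ∀ a b x y,
    α (a * b) x * starRingEnd ℂ (α (a * b) y) =
      α a (b • x) * starRingEnd ℂ (α a (b • y)) * α b x * starRingEnd ℂ (α b y)
  mul_inv : ∀ a x, α (a * a⁻¹) x = 1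

open Classical in
/-- The cocycle `σ(a, b) = α(a, b • x)⁻¹ α(b, x)⁻¹ α(ab, x)`, which does not depend on `x`
(see `cocycle_eq`); its value is irrelevant, and set to `1`, if `X` is empty. -/
noncomputable def cocycle (α : S → X → ℂ) (a b : S) : ℂ :=
  if h : Nonempty X then
    (α a (b • h.some))⁻¹ * (α b h.some)⁻¹ * α (a * b) h.some
  else 1

theorem cocycle_eq {α : S → X → ℂ} (hα : IsMultiplier α) (a b : S) (x : X) :
    cocycle α a b = (α a (b • x))⁻¹ * (α b x)⁻¹ * α (a * b) x := by
  have key : ∀ y z : X, ((α a (b • y))⁻¹ * (α b y)⁻¹ * α (a * b) y) *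
      starRingEnd ℂ ((α a (b • z))⁻¹ * (α b z)⁻¹ * α (a * b) z) = 1 := by
    intro y z
    have h := hα.mul_conj a b y z
    have h1 := hα.ne_zero a (b • y)
    have h2 := hα.ne_zero b y
    have h3 : starRingEnd ℂ (α a (b • z)) ≠ 0 := by simpa using hα.ne_zero a (b • z)
    have h4 : starRingEnd ℂ (α b z) ≠ 0 := by simpa using hα.ne_zero b z
    simp only [map_mul, map_inv₀]
    field_simp
    linear_combination h
  have hne : Nonempty X := ⟨x⟩
  rw [cocycle, dif_pos hne]
  exact mul_right_cancel₀ (right_ne_zero_of_mul_eq_one (key x x))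
    ((key hne.some x).trans (key x x).symm)

variable {H : Type*} [NormedAddCommGroup H] [InnerProductSpace ℂ H] [CompleteSpace H]
  [KreinSpace H]
variable {G : Type*} [NormedAddCommGroup G] [InnerProductSpace ℂ G] [CompleteSpace G]
  [KreinSpace G]

/-- Invariance of a kernel under the action (with the function `α` and the involution
`a ↦ a⁻¹`). -/
def IsInvariantKernel (α : S → X → ℂ) (K : X → X → H →L[ℂ] H) : Prop :=
  ∀ a x y, K x (a • y) =
    (starRingEnd ℂ (α a (a⁻¹ • x)) * α a y) • K (a⁻¹ • x) y

/-- A Kolmogorov decomposition `(V; G)` of `K` is projectively invariant if there is a projective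
representation `U` of `S` by bounded operators on `G`, `U(a) U(b) = σ(a, b) U(ab)`, with
`V(a • x) = α(a, x) U(a) V(x)`. -/
def IsProjInvKolmogorovDecomposition (α : S → X → ℂ) (K : X → X → H →L[ℂ] H)
    (V : X → H →L[ℂ] G) : Prop :=
  IsKolmogorovDecomposition K V ∧
    ∃ U : S → G →L[ℂ] G,
      (∀ a b, U a ∘L U b = cocycle (X := X) α a b • U (a * b)) ∧
      ∀ a x, V (a • x) = α a x • (U a ∘L V x)

end Actions

end KreinSpace

/-! Let E be the finitely supported functions X → H with the form b = [·,·]_K. Since b has finite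
negative signature, there is a maximal orthogonal family of vectors of square -1. Reflecting in its
span gives an involution R for which b(f, R g) is positive semidefinite. The Hilbert completion
carries an extension J of R, and J recovers b; as I - J has finite rank, the result is a Pontryagin
space. The operators V(x) are the restrictions to functions supported at x.

Uniqueness rests on `exists_norm_equiv`: if E maps with dense range and preserved form into any
Krein space, the Hilbert norm there is equivalent on the image to the seminorm from R. So two such
maps differ by a unitary (`exists_isUnitary`).

The same statement yields the projective representation: weighted translations of E preserve b and
are onto, so composing with one gives another dense form-preserving map into the same space, and the
resulting unitary is U(a). Thus every Kolmogorov decomposition of K is projectively invariant. -/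

namespace KreinSpace

open ComplexConjugate

/-! ### Maximal negative frames and the associated reflection. -/

section Frames

variable {E : Type*} [AddCommGroup E] [Module ℂ E]

/-- Orthogonal families of vectors of square `-1` for a sesquilinear form. -/
def IsNegativeFrame (b : E →ₗ⋆[ℂ] E →ₗ[ℂ] ℂ) {n : ℕ} (e : Fin n → E) : Prop :=
  ∀ i j, b (e i) (e j) = if i = j then -1 else 0

/-- The reflection changing the sign of the span of a negative frame. -/
noncomputable def reflection (b : E →ₗ⋆[ℂ] E →ₗ[ℂ] ℂ) {n : ℕ} (e : Fin n → E) : E →ₗ[ℂ] E :=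
  LinearMap.id + (2 : ℂ) • ∑ i, (b (e i)).smulRight (e i)

variable {b : E →ₗ⋆[ℂ] E →ₗ[ℂ] ℂ} {n : ℕ} {e : Fin n → E}

theorem reflection_apply (f : E) :
    reflection b e f = f + (2 : ℂ) • ∑ i, b (e i) f • e i := by
  simp [reflection]

theorem IsNegativeFrame.sum_right (he : IsNegativeFrame b e) (i : Fin n) (c : Fin n → ℂ) :
    b (e i) (∑ j, c j • e j) = -c i := by
  simp [he i _]

theorem IsNegativeFrame.sum_sum (he : IsNegativeFrame b e) (c : Fin n → ℂ) :
    b (∑ i, c i • e i) (∑ j, c j • e j) = -∑ i, (‖c i‖ ^ 2 : ℂ) := by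
  rw [LinearMap.map_sum₂, ← Finset.sum_neg_distrib]
  refine Finset.sum_congr rfl fun i _ => ?_
  rw [map_smulₛₗ, LinearMap.smul_apply, he.sum_right, smul_eq_mul, mul_neg, Complex.conj_mul']

theorem IsNegativeFrame.linearIndependent (he : IsNegativeFrame b e) :
    LinearIndependent ℂ e := by
  rw [Fintype.linearIndependent_iff]
  intro c hc i
  have h := he.sum_right i c
  rw [hc, map_zero] at h
  simpa using h.symm

theorem IsNegativeFrame.le_negSignature (he : IsNegativeFrame b e) :
    (n : ℕ∞) ≤ negSignature fun f g => b g f := by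
  have hN : ∀ v ∈ Submodule.span ℂ (Set.range e), v ≠ 0 → (b v v).re < 0 := by
    intro v hv hv0
    obtain ⟨c, rfl⟩ := (Submodule.mem_span_range_iff_exists_fun ℂ).1 hv
    rw [he.sum_sum, Complex.neg_re, neg_lt_zero]
    have h : (∑ i, (‖c i‖ ^ 2 : ℂ)).re = ∑ i, ‖c i‖ ^ 2 := by
      rw [← Complex.ofReal_re (∑ i, ‖c i‖ ^ 2)]
      push_cast
      rfl
    rw [h]
    obtain ⟨i, hi⟩ : ∃ i, c i ≠ 0 := by
      by_contra! hc
      exact hv0 (by simp [hc])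
    exact Finset.sum_pos' (fun j _ => by positivity) ⟨i, Finset.mem_univ i, by positivity⟩
  refine le_trans (le_of_eq ?_) (le_iSup _ ⟨Submodule.span ℂ (Set.range e), hN⟩)
  change _ = Cardinal.toENat (Module.rank ℂ (Submodule.span ℂ (Set.range e)))
  have := FiniteDimensional.span_of_finite ℂ (Set.finite_range e)
  rw [← Module.finrank_eq_rank, finrank_span_eq_card he.linearIndependent]
  simp

theorem ofReal_re_self (hb : ∀ f g, conj (b f g) = b g f) (f : E) : ((b f f).re : ℂ) = b f f :=
  Complex.conj_eq_iff_re.1 (hb f f)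

/-- The negative signature bounds the size of a frame, so a largest one exists. An orthogonal vector
of negative square could be normalised and adjoined to it. -/
theorem exists_maximal_negativeFrame (hb : ∀ f g, conj (b f g) = b g f)
    (hfin : negSignature (fun f g => b g f) < ⊤) :
    ∃ (n : ℕ) (e : Fin n → E), IsNegativeFrame b e ∧
      ∀ v, (∀ i, b (e i) v = 0) → 0 ≤ (b v v).re := by
  classical
  obtain ⟨k, hk⟩ := ENat.ne_top_iff_exists.1 hfin.ne
  set P : ℕ → Prop := fun n => ∃ e : Fin n → E, IsNegativeFrame b e
  have hP : ∀ n, P n → n ≤ k := fun n ⟨e, he⟩ => by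
    have := he.le_negSignature
    rw [← hk] at this
    exact_mod_cast this
  have hP0 : P 0 := ⟨Fin.elim0, fun i => i.elim0⟩
  obtain ⟨e, he⟩ := Nat.findGreatest_spec (Nat.zero_le k) hP0
  refine ⟨_, e, he, fun v hv => ?_⟩
  by_contra! hneg
  have hr : 0 < -(b v v).re := by linarith
  -- The scaling that gives t • v square -1.
  set t : ℝ := (Real.sqrt (-(b v v).re))⁻¹
  have ht : t * t * (b v v).re = -1 := by
    have h1 : Real.sqrt (-(b v v).re) * Real.sqrt (-(b v v).re) = -(b v v).re :=
      Real.mul_self_sqrt hr.le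
    have h2 : Real.sqrt (-(b v v).re) ≠ 0 := (Real.sqrt_pos.2 hr).ne'
    simp only [t]
    field_simp
    rw [sq, h1]
    ring
  have hv' : ∀ i, b v (e i) = 0 := fun i => by rw [← hb, hv, map_zero]
  have hnew : P (Nat.findGreatest P k + 1) := by
    refine ⟨Fin.cons ((t : ℂ) • v) e, fun i j => ?_⟩
    refine Fin.cases ?_ (fun i => ?_) i <;> refine Fin.cases ?_ (fun j => ?_) j
    · simp only [Fin.cons_zero, map_smulₛₗ, LinearMap.smul_apply, Complex.conj_ofReal,
        smul_eq_mul, if_true, RingHom.id_apply]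
      rw [← ofReal_re_self hb v]
      exact_mod_cast (mul_assoc t t _).symm.trans ht
    · rw [Fin.cons_zero, Fin.cons_succ, map_smulₛₗ, LinearMap.smul_apply, hv', smul_zero,
        if_neg (Fin.succ_ne_zero j).symm]
    · simp [hv, Fin.succ_ne_zero i]
    · simpa using he i j
  exact absurd (Nat.le_findGreatest (hP _ hnew) hnew) (by omega)

theorem reflection_reflection (he : IsNegativeFrame b e) (f : E) :
    reflection b e (reflection b e f) = f := by
  have h : ∀ i, b (e i) (reflection b e f) = -b (e i) f := fun i => by
    rw [reflection_apply, map_add, map_smul, he.sum_right, smul_eq_mul]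
    ring
  rw [reflection_apply (reflection b e f)]
  simp only [h, neg_smul, Finset.sum_neg_distrib]
  rw [reflection_apply]
  module

theorem apply_reflection (f g : E) :
    b f (reflection b e g) = b f g + 2 * ∑ i, b f (e i) * b (e i) g := by
  rw [reflection_apply]
  simp [mul_comm]

theorem reflection_left (hb : ∀ f g, conj (b f g) = b g f) (f g : E) :
    b (reflection b e f) g = b f (reflection b e g) := by
  rw [← hb, apply_reflection, apply_reflection]
  simp [hb, mul_comm, map_ofNat]

theorem self_reflection (hb : ∀ f g, conj (b f g) = b g f) (f : E) :
    (b f (reflection b e f)).re = (b f f).re + 2 * ∑ i, ‖b (e i) f‖ ^ 2 := by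
  rw [apply_reflection]
  have : ∀ i, b f (e i) * b (e i) f = ((‖b (e i) f‖ ^ 2 : ℝ) : ℂ) := fun i => by
    rw [← hb (e i) f, Complex.conj_mul']
    push_cast
    rfl
  simp only [this]
  rw [← Complex.ofReal_sum]
  simp [-Complex.ofReal_sum]

/-- With s as below, f + s is the component of f orthogonal to the frame, and b(f, R f) = b(f + s, f
+ s) + ∑ |b(e i, f)|². Maximality makes the first term nonnegative. -/
theorem self_reflection_nonneg (hb : ∀ f g, conj (b f g) = b g f) (he : IsNegativeFrame b e)
    (hmax : ∀ v, (∀ i, b (e i) v = 0) → 0 ≤ (b v v).re) (f : E) :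
    0 ≤ (b f (reflection b e f)).re := by
  set s : E := ∑ i, b (e i) f • e i
  have h1 : ∀ i, b (e i) (f + s) = 0 := fun i => by
    rw [map_add, he.sum_right]
    ring
  have h2 : b s (f + s) = 0 := by
    simp only [s, map_sum, LinearMap.sum_apply, map_smulₛₗ, LinearMap.smul_apply]
    exact Finset.sum_eq_zero fun i _ => by rw [h1, smul_zero]
  have h3 : (b (f + s) (f + s)).re = (b f f).re + ∑ i, ‖b (e i) f‖ ^ 2 := by
    rw [LinearMap.map_add₂, h2, add_zero, map_add, Complex.add_re]
    congr 1
    have : b f s = ((∑ i, ‖b (e i) f‖ ^ 2 : ℝ) : ℂ) := by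
      simp only [s, map_sum, map_smul, smul_eq_mul]
      push_cast
      exact Finset.sum_congr rfl fun i _ => by rw [← hb (e i) f, Complex.mul_conj']
    rw [this, Complex.ofReal_re]
  have h4 := hmax _ h1
  have h5 : 0 ≤ ∑ i, ‖b (e i) f‖ ^ 2 := Finset.sum_nonneg fun i _ => by positivity
  rw [self_reflection hb]
  linarith

/-- The positive semidefinite inner product obtained from a hermitian form by changing the sign on
the span of a maximal negative frame. -/
@[reducible]
noncomputable def majorantCore (hb : ∀ f g, conj (b f g) = b g f) (he : IsNegativeFrame b e)
    (hmax : ∀ v, (∀ i, b (e i) v = 0) → 0 ≤ (b v v).re) : PreInnerProductSpace.Core ℂ E where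
  inner f g := b f (reflection b e g)
  conj_inner_symm f g := by rw [hb, reflection_left hb]
  re_inner_nonneg f := self_reflection_nonneg hb he hmax f
  add_left f g h := by simp
  smul_left f g r := by simp

/-- The Hilbert space completion of a space with a hermitian form and a maximal negative frame. -/
theorem exists_completion {E : Type u} [AddCommGroup E] [Module ℂ E]
    {b : E →ₗ⋆[ℂ] E →ₗ[ℂ] ℂ} {e : Fin n → E}
    (hb : ∀ f g, conj (b f g) = b g f) (he : IsNegativeFrame b e)
    (hmax : ∀ v, (∀ i, b (e i) v = 0) → 0 ≤ (b v v).re) :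
    ∃ (G : Type u) (_ : NormedAddCommGroup G) (_ : InnerProductSpace ℂ G) (_ : CompleteSpace G)
      (ι : E →ₗ[ℂ] G), DenseRange ι ∧ ∀ f g, inner ℂ (ι f) (ι g) = b f (reflection b e g) := by
  let c := majorantCore hb he hmax
  let _ : SeminormedAddCommGroup E := InnerProductSpace.Core.toSeminormedAddCommGroup (𝕜 := ℂ)
  let _ : InnerProductSpace ℂ E := InnerProductSpace.ofCore c
  -- The completion is Hausdorff, so null vectors of the semidefinite product are collapsed and the
  -- map ι need not be injective.
  refine ⟨UniformSpace.Completion E, inferInstance, inferInstance, inferInstance,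
    (UniformSpace.Completion.toComplL (𝕜 := ℂ) (E := E)).toLinearMap, ?_, fun f g => ?_⟩
  · exact UniformSpace.Completion.denseRange_coe
  · exact UniformSpace.Completion.inner_coe f g

end Frames

/-! ### Krein spaces containing a given inner product space densely. -/

section Krein

variable {G : Type*} [NormedAddCommGroup G] [InnerProductSpace ℂ G] [CompleteSpace G]
  [KreinSpace G]
variable {G₁ : Type*} [NormedAddCommGroup G₁] [InnerProductSpace ℂ G₁] [CompleteSpace G₁]
  [KreinSpace G₁]
variable {G₂ : Type*} [NormedAddCommGroup G₂] [InnerProductSpace ℂ G₂] [CompleteSpace G₂]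
  [KreinSpace G₂]

theorem symm_symm (x : G) : symm (symm x) = x := by
  simpa using DFunLike.congr_fun (symm_comp_symm (H := G)) x

theorem inner_symm_left (x y : G) : inner ℂ (symm x) y = inner ℂ x (symm y) := by
  rw [← ContinuousLinearMap.adjoint_inner_right, adjoint_symm]

theorem conj_indef (x y : G) : conj (indef x y) = indef y x := by
  rw [indef, indef, inner_conj_symm, inner_symm_left]

theorem continuous_indef_left (y : G) : Continuous fun x : G => indef x y := by
  unfold indef
  fun_prop

theorem continuous_indef_right (x : G) : Continuous fun y : G => indef x y := by
  unfold indef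
  fun_prop

theorem eq_of_indef_eq {x y : G} (h : ∀ z, indef z x = indef z y) : x = y := by
  refine ext_inner_right ℂ fun z => ?_
  simpa [indef, symm_symm] using h (symm z)

theorem eq_of_indef_eq_of_dense {E : Type*} {W : E → G} (hW : DenseRange W) {x y : G}
    (h : ∀ f, indef (W f) x = indef (W f) y) : x = y :=
  eq_of_indef_eq fun z => congrFun (hW.equalizer (continuous_indef_left x)
    (continuous_indef_left y) (funext h)) z

theorem eq_sharp_of_indef {T : G₁ →L[ℂ] G₂} {S : G₂ →L[ℂ] G₁}
    (h : ∀ ξ η, indef (T ξ) η = indef ξ (S η)) : sharp T = S := by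
  ext η
  exact eq_of_indef_eq fun ξ => by rw [← indef_sharp, h]

theorem indef_self_nonneg_of_symm_eq {v : G} (hv : symm v = v) : 0 ≤ (indef v v).re := by
  rw [indef, hv]
  exact inner_self_nonneg (𝕜 := ℂ)

/-- Vectors fixed by J have nonnegative square, so I - J is injective on every negative subspace and
embeds it in M. -/
theorem isPontryagin_of_range_le (M : Submodule ℂ G) [FiniteDimensional ℂ M]
    (hM : ∀ x : G, x - symm x ∈ M) : IsPontryagin G := by
  refine lt_of_le_of_lt (iSup_le (a := (Module.finrank ℂ M : ℕ∞)) fun N => ?_)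
    (ENat.natCast_lt_top _)
  let T : N.1 →ₗ[ℂ] M :=
    ((LinearMap.id - (symm : G →L[ℂ] G).toLinearMap).codRestrict M hM) ∘ₗ N.1.subtype
  have hT : Function.Injective T := by
    rw [← LinearMap.ker_eq_bot, LinearMap.ker_eq_bot']
    intro v hv
    have hv' : symm (v : G) = v := (sub_eq_zero.1 (congrArg Subtype.val hv)).symm
    by_contra h0
    have := N.2 v v.2 (by simpa using h0)
    exact absurd (indef_self_nonneg_of_symm_eq hv') (not_le.2 this)
  have := Module.Finite.of_injective T hT
  rw [← Module.finrank_eq_rank, map_natCast]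
  exact_mod_cast LinearMap.finrank_le_finrank_of_injective hT

/-- A positive operator with a bounded left inverse is coercive. -/
theorem exists_norm_sq_le_of_isPositive {G : Type*} [NormedAddCommGroup G]
    [InnerProductSpace ℂ G] {T S : G →L[ℂ] G} (hT : T.IsPositive)
    (hS : ∀ x, S (T x) = x) : ∃ C, 0 ≤ C ∧ ∀ x, ‖x‖ ^ 2 ≤ C * (inner ℂ x (T x)).re := by
  -- Any positive bound for ‖T‖ would do; the 1 allows division by m even when T = 0.
  set m : ℝ := ‖T‖ + 1
  have hm : 0 < m := by positivity
  have hsymm : ∀ x y, inner ℂ (T x) y = inner ℂ x (T y) := hT.isSymmetric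
  have key : ∀ x, ‖T x‖ ^ 2 ≤ m * (inner ℂ x (T x)).re := by
    intro x
    -- Expanding this and using ⟨T x, T (T x)⟩ ≤ m ‖T x‖² leaves m (m ⟨x, T x⟩ - ‖T x‖²) ≥ 0.
    have h0 := hT.re_inner_nonneg_right ((m : ℂ) • x - T x)
    have h1 : (inner ℂ ((m : ℂ) • x - T x) (T ((m : ℂ) • x - T x))).re =
        m ^ 2 * (inner ℂ x (T x)).re - 2 * m * ‖T x‖ ^ 2 + (inner ℂ (T x) (T (T x))).re := by
      have h2 : inner ℂ x (T (T x)) = ((‖T x‖ ^ 2 : ℝ) : ℂ) := by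
        rw [← hsymm, inner_self_eq_norm_sq_to_K]
        norm_cast
      have h3 : inner ℂ (T x) (T x) = ((‖T x‖ ^ 2 : ℝ) : ℂ) := by
        rw [inner_self_eq_norm_sq_to_K]
        norm_cast
      simp only [map_sub, map_smul, inner_sub_left, inner_sub_right, inner_smul_left,
        inner_smul_right, Complex.conj_ofReal, h2, h3, Complex.sub_re, Complex.re_ofReal_mul,
        Complex.ofReal_re]
      ring
    have h4 : (inner ℂ (T x) (T (T x))).re ≤ m * ‖T x‖ ^ 2 := by
      refine (Complex.re_le_norm _).trans ((norm_inner_le_norm _ _).trans ?_)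
      have h5 := T.le_opNorm (T x)
      have h6 : ‖T‖ ≤ m := by simp [m]
      nlinarith [norm_nonneg (T x), mul_le_mul_of_nonneg_right h6 (norm_nonneg (T x))]
    change 0 ≤ (inner ℂ ((m : ℂ) • x - T x) (T ((m : ℂ) • x - T x))).re at h0
    rw [h1] at h0
    have h7 : 0 ≤ m * (m * (inner ℂ x (T x)).re - ‖T x‖ ^ 2) := by linarith
    linarith [nonneg_of_mul_nonneg_right h7 hm]
  refine ⟨‖S‖ ^ 2 * m, by positivity, fun x => ?_⟩
  calc ‖x‖ ^ 2 = ‖S (T x)‖ ^ 2 := by rw [hS]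
    _ ≤ (‖S‖ * ‖T x‖) ^ 2 := by gcongr; exact S.le_opNorm _
    _ = ‖S‖ ^ 2 * ‖T x‖ ^ 2 := by ring
    _ ≤ ‖S‖ ^ 2 * (m * (inner ℂ x (T x)).re) := by gcongr; exact key x
    _ = _ := by ring

variable {E : Type*} [AddCommGroup E] [Module ℂ E] {b : E →ₗ⋆[ℂ] E →ₗ[ℂ] ℂ}
  {n : ℕ} {e : Fin n → E}

/-- In a Krein space that contains `E` densely, the norm is equivalent to the norm given by a
maximal negative frame of `E`. -/
theorem exists_norm_equiv (hb : ∀ f g, conj (b f g) = b g f) (he : IsNegativeFrame b e)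
    (hmax : ∀ v, (∀ i, b (e i) v = 0) → 0 ≤ (b v v).re) (W : E →ₗ[ℂ] G) (hd : DenseRange W)
    (hW : ∀ f g, indef (W g) (W f) = b f g) :
    ∃ C, 0 ≤ C ∧ (∀ f, ‖W f‖ ^ 2 ≤ C * (b f (reflection b e f)).re) ∧
      ∀ f, (b f (reflection b e f)).re ≤ C * ‖W f‖ ^ 2 := by
  -- The bounded extension of the reflection to G: the functional b(e i, ·) becomes x ↦ [x, W (e
  -- i)].
  let R : G →L[ℂ] G := ContinuousLinearMap.id ℂ G +
    (2 : ℂ) • ∑ i, (innerSL ℂ (symm (W (e i)))).smulRight (W (e i))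
  have hR : ∀ f, R (W f) = W (reflection b e f) := by
    intro f
    have h : ∀ i, inner ℂ (symm (W (e i))) (W f) = b (e i) f := fun i => by
      rw [inner_symm_left, ← hW, indef]
    simp [R, reflection_apply, h]
  have hRR : ∀ x, R (R x) = x := fun x => by
    refine congrFun (hd.equalizer (R.continuous.comp R.continuous) continuous_id
      (funext fun f => ?_)) x
    simp [hR, reflection_reflection he]
  -- T represents b(f, R g) in the Hilbert inner product of G. It is positive by density and has the
  -- bounded inverse R J, hence is coercive.
  let T : G →L[ℂ] G := symm ∘L R
  have hT : ∀ f g, inner ℂ (W f) (T (W g)) = b f (reflection b e g) := fun f g => by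
    simp only [T, ContinuousLinearMap.comp_apply, hR, ← hW, indef]
  have hTs : ∀ x y, inner ℂ (T x) y = inner ℂ x (T y) := by
    intro x y
    refine hd.induction_on₂ (p := fun x y => inner ℂ (T x) y = inner ℂ x (T y))
      (isClosed_eq (by fun_prop) (by fun_prop)) (fun f g => ?_) x y
    rw [hT, ← inner_conj_symm, hT, hb, reflection_left hb]
  have hTn : ∀ x, 0 ≤ (inner ℂ (T x) x).re := by
    intro x
    refine hd.induction_on (p := fun x => 0 ≤ (inner ℂ (T x) x).re) x
      (isClosed_le continuous_const (Complex.continuous_re.comp (by fun_prop))) fun f => ?_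
    rw [hTs, hT]
    exact self_reflection_nonneg hb he hmax f
  have hTpos : T.IsPositive := ⟨hTs, hTn⟩
  obtain ⟨C, hC, h⟩ := exists_norm_sq_le_of_isPositive (S := R ∘L symm) hTpos fun x => by
    simp [T, symm_symm, hRR]
  refine ⟨max C ‖T‖, le_max_of_le_left hC, fun f => ?_, fun f => ?_⟩
  · refine (h (W f)).trans ?_
    rw [hT]
    exact mul_le_mul_of_nonneg_right (le_max_left _ _) (self_reflection_nonneg hb he hmax f)
  · rw [← hT]
    refine (Complex.re_le_norm _).trans ((norm_inner_le_norm _ _).trans ?_)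
    calc ‖W f‖ * ‖T (W f)‖ ≤ ‖W f‖ * (‖T‖ * ‖W f‖) := by gcongr; exact T.le_opNorm _
      _ = ‖T‖ * ‖W f‖ ^ 2 := by ring
      _ ≤ _ := by gcongr; exact le_max_right _ _

/-- Both norms are compared with the seminorm of one common frame in E. -/
theorem exists_norm_le_of_indef_eq (hb : ∀ f g, conj (b f g) = b g f)
    (hfin : negSignature (fun f g => b g f) < ⊤)
    (W₁ : E →ₗ[ℂ] G₁) (hd₁ : DenseRange W₁) (hW₁ : ∀ f g, indef (W₁ g) (W₁ f) = b f g)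
    (W₂ : E →ₗ[ℂ] G₂) (hd₂ : DenseRange W₂) (hW₂ : ∀ f g, indef (W₂ g) (W₂ f) = b f g) :
    ∃ C, ∀ f, ‖W₂ f‖ ≤ C * ‖W₁ f‖ := by
  obtain ⟨n, e, he, hmax⟩ := exists_maximal_negativeFrame hb hfin
  obtain ⟨C₁, hC₁, -, h₁⟩ := exists_norm_equiv hb he hmax W₁ hd₁ hW₁
  obtain ⟨C₂, hC₂, h₂, -⟩ := exists_norm_equiv hb he hmax W₂ hd₂ hW₂
  refine ⟨Real.sqrt (C₂ * C₁), fun f => ?_⟩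
  refine le_of_sq_le_sq ?_ (by positivity)
  rw [mul_pow, Real.sq_sqrt (by positivity), mul_assoc]
  exact (h₂ f).trans (mul_le_mul_of_nonneg_left (h₁ f) hC₂)

/-- Two Krein spaces that contain the same inner product space of finite negative signature
densely are unitarily equivalent. -/
theorem exists_isUnitary (hb : ∀ f g, conj (b f g) = b g f)
    (hfin : negSignature (fun f g => b g f) < ⊤)
    (W₁ : E →ₗ[ℂ] G₁) (hd₁ : DenseRange W₁) (hW₁ : ∀ f g, indef (W₁ g) (W₁ f) = b f g)
    (W₂ : E →ₗ[ℂ] G₂) (hd₂ : DenseRange W₂) (hW₂ : ∀ f g, indef (W₂ g) (W₂ f) = b f g) :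
    ∃ Φ : G₁ →L[ℂ] G₂, IsUnitary Φ ∧ ∀ f, Φ (W₁ f) = W₂ f := by
  have hΦ := W₂.extendOfNorm_eq hd₁ (exists_norm_le_of_indef_eq hb hfin W₁ hd₁ hW₁ W₂ hd₂ hW₂)
  have hΨ := W₁.extendOfNorm_eq hd₂ (exists_norm_le_of_indef_eq hb hfin W₂ hd₂ hW₂ W₁ hd₁ hW₁)
  set Φ : G₁ →L[ℂ] G₂ := W₂.extendOfNorm W₁
  set Ψ : G₂ →L[ℂ] G₁ := W₁.extendOfNorm W₂
  -- By continuity in each variable it suffices to test on the dense ranges, where both sides equal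
  -- b.
  have hs : sharp Φ = Ψ := eq_sharp_of_indef fun ξ η => by
    refine hd₁.induction_on (p := fun ξ => indef (Φ ξ) η = indef ξ (Ψ η)) ξ
      (isClosed_eq ((continuous_indef_left _).comp Φ.continuous) (continuous_indef_left _))
      fun f => ?_
    refine hd₂.induction_on (p := fun η => indef (Φ (W₁ f)) η = indef (W₁ f) (Ψ η)) η
      (isClosed_eq (continuous_indef_right _) ((continuous_indef_right _).comp Ψ.continuous))
      fun g => ?_
    rw [hΦ, hΨ, hW₁, hW₂]
  refine ⟨Φ, ⟨?_, ?_⟩, hΦ⟩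
  · rw [hs]
    exact DFunLike.coe_injective (hd₁.equalizer (Ψ ∘L Φ).continuous continuous_id
      (funext fun f => by simp [hΦ, hΨ]))
  · rw [hs]
    exact DFunLike.coe_injective (hd₂.equalizer (Φ ∘L Ψ).continuous continuous_id
      (funext fun f => by simp [hΦ, hΨ]))

end Krein

/-! ### Completion to a Pontryagin space. -/

/-- A space with a hermitian form of finite negative signature has a completion to a
Pontryagin space. -/
theorem exists_pontryagin_completion {E : Type u} [AddCommGroup E] [Module ℂ E]
    {b : E →ₗ⋆[ℂ] E →ₗ[ℂ] ℂ} (hb : ∀ f g, conj (b f g) = b g f)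
    (hfin : negSignature (fun f g => b g f) < ⊤) :
    ∃ (G : Type u) (_ : NormedAddCommGroup G) (_ : InnerProductSpace ℂ G) (_ : CompleteSpace G)
      (_ : KreinSpace G) (ι : E →ₗ[ℂ] G), IsPontryagin G ∧ DenseRange ι ∧
      ∀ f g, indef (ι g) (ι f) = b f g := by
  obtain ⟨n, e, he, hmax⟩ := exists_maximal_negativeFrame hb hfin
  obtain ⟨G, _, _, _, ι, hd, hι⟩ := exists_completion hb he hmax
  -- The reflection is isometric for the majorant, so it descends through the kernel of ι and
  -- extends to G.
  have hnorm : ∀ f, ‖ι (reflection b e f)‖ ≤ 1 * ‖ι f‖ := fun f => by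
    rw [one_mul, norm_eq_sqrt_re_inner (𝕜 := ℂ), norm_eq_sqrt_re_inner (𝕜 := ℂ) (ι f), hι, hι,
      reflection_left hb, reflection_reflection he]
  have hJ := (ι ∘ₗ reflection b e).extendOfNorm_eq hd ⟨1, hnorm⟩
  set J : G →L[ℂ] G := (ι ∘ₗ reflection b e).extendOfNorm ι
  simp only [LinearMap.comp_apply] at hJ
  have hadj : ContinuousLinearMap.adjoint J = J := by
    refine ((ContinuousLinearMap.eq_adjoint_iff _ _).2 fun x y => ?_).symm
    refine hd.induction_on₂ (p := fun x y => inner ℂ (J x) y = inner ℂ x (J y))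
      (isClosed_eq (by fun_prop) (by fun_prop)) (fun f g => ?_) x y
    rw [hJ, hJ, hι, hι, reflection_left hb]
  have hsq : J ∘L J = ContinuousLinearMap.id ℂ G :=
    DFunLike.coe_injective (hd.equalizer (J ∘L J).continuous continuous_id
      (funext fun f => by simp [hJ, reflection_reflection he]))
  let inst : KreinSpace G := ⟨J, hadj, hsq⟩
  refine ⟨G, _, _, _, inst, ι, ?_, hd, fun f g => ?_⟩
  · have := FiniteDimensional.span_of_finite ℂ (Set.finite_range (ι ∘ e))
    -- On the range of ι, I - J takes values in the span of the frame, which is finite-dimensional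
    -- and therefore closed.
    refine isPontryagin_of_range_le (Submodule.span ℂ (Set.range (ι ∘ e))) fun x => ?_
    refine hd.induction_on
      (p := fun x : G => x - J x ∈ Submodule.span ℂ (Set.range (ι ∘ e))) x
      ((Submodule.closed_of_finiteDimensional _).preimage (by fun_prop)) fun f => ?_
    rw [hJ, reflection_apply, map_add, sub_add_cancel_left, map_smul, map_sum]
    refine Submodule.neg_mem _ (Submodule.smul_mem _ _ (Submodule.sum_mem _ fun i _ => ?_))
    rw [map_smul]
    exact Submodule.smul_mem _ _ (Submodule.subset_span ⟨i, rfl⟩)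
  · change inner ℂ (ι f) (J (ι g)) = _
    rw [hJ, hι, reflection_reflection he]

/-! ### Kernels and Kolmogorov decompositions. -/

section Kernels

variable {X : Type*}
variable {H : Type*} [NormedAddCommGroup H] [InnerProductSpace ℂ H] [CompleteSpace H]
  [KreinSpace H]
variable {G : Type*} [NormedAddCommGroup G] [InnerProductSpace ℂ G] [CompleteSpace G]
  [KreinSpace G]

/-- The indefinite inner product as a sesquilinear form, conjugate linear in the first argument. -/
noncomputable def indefForm (G : Type*) [NormedAddCommGroup G] [InnerProductSpace ℂ G]
    [CompleteSpace G] [KreinSpace G] : G →ₗ⋆[ℂ] G →ₗ[ℂ] ℂ :=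
  LinearMap.mk₂'ₛₗ (starRingEnd ℂ) (RingHom.id ℂ) (fun η ξ => indef ξ η)
    (by simp [indef]) (by simp [indef, mul_comm]) (by simp [indef]) (by simp [indef])

theorem indefForm_apply (ξ η : G) : indefForm G η ξ = indef ξ η := rfl

/-- The inner product of a kernel as a sesquilinear form, conjugate linear in the first argument. -/
noncomputable def kernelForm (K : X → X → H →L[ℂ] H) : (X →₀ H) →ₗ⋆[ℂ] (X →₀ H) →ₗ[ℂ] ℂ :=
  LinearMap.mk₂'ₛₗ (starRingEnd ℂ) (RingHom.id ℂ) (fun g f => kernelInner K f g)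
    (fun g₁ g₂ f => by
      unfold kernelInner
      refine Finsupp.sum_add_index' (fun x => ?_) fun x h₁ h₂ => ?_ <;>
        simp [← indefForm_apply, Finsupp.sum, Finset.sum_add_distrib])
    (fun c g f => by
      unfold kernelInner
      rw [Finsupp.sum_smul_index' fun x => by simp [← indefForm_apply, Finsupp.sum]]
      simp [← indefForm_apply, Finsupp.sum, Finset.mul_sum])
    (fun g f₁ f₂ => by
      unfold kernelInner
      rw [← Finsupp.sum_add]
      refine Finsupp.sum_congr fun x _ => ?_
      refine Finsupp.sum_add_index' (fun y => ?_) fun y h₁ h₂ => ?_ <;>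
        simp [← indefForm_apply])
    (fun c g f => by
      unfold kernelInner
      simp only [Finsupp.sum, RingHom.id_apply, smul_eq_mul, Finset.mul_sum]
      refine Finset.sum_congr rfl fun x _ => ?_
      have := Finsupp.sum_smul_index' (g := f) (b := c)
        (h := fun y h => indef (K x y h) (g x)) fun y => by simp [← indefForm_apply]
      simp only [Finsupp.sum] at this
      rw [this]
      simp [← indefForm_apply])

theorem kernelForm_apply (K : X → X → H →L[ℂ] H) (f g : X →₀ H) :
    kernelForm K g f = kernelInner K f g := rfl

theorem kernelForm_single_single (K : X → X → H →L[ℂ] H) (x y : X) (h k : H) :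
    kernelForm K (Finsupp.single x k) (Finsupp.single y h) = indef (K x y h) k := by
  simp [kernelForm_apply, kernelInner, ← indefForm_apply]

theorem kernelForm_ext {K : X → X → H →L[ℂ] H} {B : (X →₀ H) →ₗ⋆[ℂ] (X →₀ H) →ₗ[ℂ] ℂ}
    (h : ∀ x y k h, B (Finsupp.single x k) (Finsupp.single y h) = indef (K x y h) k) (f g) :
    B f g = kernelForm K f g := by
  induction f using Finsupp.induction_linear with
  | zero => simp
  | add f₁ f₂ h₁ h₂ => rw [LinearMap.map_add₂, LinearMap.map_add₂, h₁, h₂]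
  | single x k =>
    induction g using Finsupp.induction_linear with
    | zero => simp
    | add g₁ g₂ h₁ h₂ => rw [map_add, map_add, h₁, h₂]
    | single y l => rw [h, kernelForm_single_single]

theorem IsHermitianKernel.conj_kernelForm {K : X → X → H →L[ℂ] H} (hK : IsHermitianKernel K)
    (f g : X →₀ H) : conj (kernelForm K f g) = kernelForm K g f := by
  induction f using Finsupp.induction_linear with
  | zero => simp
  | add f₁ f₂ h₁ h₂ => rw [LinearMap.map_add₂, map_add, map_add, h₁, h₂]
  | single x k =>
    induction g using Finsupp.induction_linear with
    | zero => simp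
    | add g₁ g₂ h₁ h₂ => rw [LinearMap.map_add₂, map_add, map_add, h₁, h₂]
    | single y l =>
      rw [kernelForm_single_single, kernelForm_single_single, conj_indef, indef_sharp, ← hK]

/-- The map `f ↦ ∑ x, V x (f x)`. -/
noncomputable def synthesis (V : X → H →L[ℂ] G) : (X →₀ H) →ₗ[ℂ] G :=
  Finsupp.lsum ℂ fun x => (V x).toLinearMap

omit [CompleteSpace H] [KreinSpace H] [CompleteSpace G] [KreinSpace G] in
theorem synthesis_single (V : X → H →L[ℂ] G) (x : X) (h : H) :
    synthesis V (Finsupp.single x h) = V x h := by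
  simp [synthesis]

omit [CompleteSpace H] [KreinSpace H] [CompleteSpace G] [KreinSpace G] in
theorem range_synthesis (V : X → H →L[ℂ] G) :
    LinearMap.range (synthesis V) = ⨆ x, LinearMap.range (V x).toLinearMap := by
  refine le_antisymm ?_ (iSup_le fun x => ?_)
  · rintro _ ⟨f, rfl⟩
    rw [synthesis, Finsupp.lsum_apply]
    exact Submodule.sum_mem _ fun x _ => Submodule.mem_iSup_of_mem x ⟨f x, rfl⟩
  · rintro _ ⟨h, rfl⟩
    exact ⟨Finsupp.single x h, synthesis_single V x h⟩

theorem denseRange_synthesis_iff (V : X → H →L[ℂ] G) :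
    DenseRange (synthesis V) ↔
      (⨆ x, LinearMap.range (V x).toLinearMap).topologicalClosure = ⊤ := by
  rw [← range_synthesis, ← Submodule.dense_iff_topologicalClosure_eq_top]
  rfl

theorem indef_synthesis {K : X → X → H →L[ℂ] H} {V : X → H →L[ℂ] G}
    (hV : ∀ x y, K x y = sharp (V x) ∘L V y) (f g : X →₀ H) :
    indef (synthesis V g) (synthesis V f) = kernelForm K f g := by
  refine kernelForm_ext
    (B := ((indefForm G).comp (synthesis V)).compl₂ (synthesis V)) (fun x y k h => ?_) f g
  simp only [LinearMap.compl₂_apply, LinearMap.comp_apply, synthesis_single, indefForm_apply]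
  rw [hV, ContinuousLinearMap.comp_apply, ← conj_indef, indef_sharp, conj_indef]

/-- A form-preserving linear map with dense range from the finitely supported functions to a Krein
space comes from a Kolmogorov decomposition. -/
theorem exists_kolmogorovDecomposition {K : X → X → H →L[ℂ] H} (ι : (X →₀ H) →ₗ[ℂ] G)
    (hd : DenseRange ι) (hι : ∀ f g, indef (ι g) (ι f) = kernelForm K f g) :
    ∃ V : X → H →L[ℂ] G, IsKolmogorovDecomposition K V ∧ synthesis V = ι := by
  have hc : ∀ x, Continuous (ι ∘ₗ Finsupp.lsingle x) := fun x => by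
    -- Closed graph theorem in place of a norm estimate: the functionals [ι f, ·] separate points of
    -- G, and composed with k ↦ ι (δ_x k) they are continuous because the entries of K are bounded.
    refine LinearMap.continuous_of_seq_closed_graph _ fun u h y hu hy => ?_
    refine eq_of_indef_eq_of_dense hd fun f => ?_
    have h1 : Continuous fun k : H => indef (ι f) (ι (Finsupp.single x k)) := by
      simp only [hι]
      induction f using Finsupp.induction_linear with
      | zero => simpa using continuous_const
      | add f₁ f₂ h₁ h₂ => simpa [Pi.add_def] using h₁.add h₂
      | single z l =>
        simp only [kernelForm_single_single]
        exact continuous_indef_right _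
    exact tendsto_nhds_unique (((continuous_indef_right (ι f)).tendsto y).comp hy)
      ((h1.tendsto h).comp hu)
  let V : X → H →L[ℂ] G := fun x => ⟨ι ∘ₗ Finsupp.lsingle x, hc x⟩
  have hV : ∀ x h, V x h = ι (Finsupp.single x h) := fun x h => rfl
  have hs : synthesis V = ι := by
    ext x h
    simp [synthesis_single, hV]
  refine ⟨V, ⟨fun x y => ?_, (denseRange_synthesis_iff V).1 (hs ▸ hd)⟩, hs⟩
  ext h
  refine eq_of_indef_eq fun k => ?_
  rw [ContinuousLinearMap.comp_apply, ← indef_sharp, hV, hV, ← conj_indef,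
    ← kernelForm_single_single, ← hι, conj_indef]

/-- Kolmogorov decompositions of a hermitian kernel with finitely many negative squares are unique
up to unitary equivalence. -/
theorem IsKolmogorovDecomposition.exists_isUnitary {G₁ : Type*} [NormedAddCommGroup G₁]
    [InnerProductSpace ℂ G₁] [CompleteSpace G₁] [KreinSpace G₁] {G₂ : Type*}
    [NormedAddCommGroup G₂] [InnerProductSpace ℂ G₂] [CompleteSpace G₂] [KreinSpace G₂]
    {K : X → X → H →L[ℂ] H} (hK : IsHermitianKernel K) (hneg : HasFinitelyManyNegativeSquares K)
    {V₁ : X → H →L[ℂ] G₁} {V₂ : X → H →L[ℂ] G₂} (h₁ : IsKolmogorovDecomposition K V₁)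
    (h₂ : IsKolmogorovDecomposition K V₂) :
    ∃ Φ : G₁ →L[ℂ] G₂, IsUnitary Φ ∧ ∀ x, V₂ x = Φ ∘L V₁ x := by
  obtain ⟨Φ, hΦ, h⟩ := KreinSpace.exists_isUnitary hK.conj_kernelForm hneg
    (synthesis V₁) ((denseRange_synthesis_iff V₁).2 h₁.2) (indef_synthesis h₁.1)
    (synthesis V₂) ((denseRange_synthesis_iff V₂).2 h₂.2) (indef_synthesis h₂.1)
  refine ⟨Φ, hΦ, fun x => ?_⟩
  ext k
  simpa [synthesis_single] using (h (Finsupp.single x k)).symm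

end Kernels

/-! ### Group action and projective representation. -/

section Actions

variable {S : Type*} [Group S] {X : Type*} [MulAction S X]
variable {H : Type*} [NormedAddCommGroup H] [InnerProductSpace ℂ H] [CompleteSpace H]
  [KreinSpace H]

omit [CompleteSpace H] [KreinSpace H] in
theorem IsInvariantKernel.smul_smul {α : S → X → ℂ} {K : X → X → H →L[ℂ] H}
    (hinv : IsInvariantKernel α K) (a : S) (x y : X) :
    K (a • x) (a • y) = (conj (α a x) * α a y) • K x y := by
  rw [hinv, inv_smul_smul]

/-- The weighted translation `δ_y h ↦ α(a, y)⁻¹ δ_{a y} h` of finitely supported functions. -/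
noncomputable def translation (H : Type*) [AddCommGroup H] [Module ℂ H] (α : S → X → ℂ) (a : S) :
    (X →₀ H) →ₗ[ℂ] (X →₀ H) :=
  Finsupp.lsum ℂ fun y => (α a y)⁻¹ • Finsupp.lsingle (a • y)

omit [CompleteSpace H] [KreinSpace H] in
theorem translation_single (α : S → X → ℂ) (a : S) (y : X) (h : H) :
    translation H α a (Finsupp.single y h) = (α a y)⁻¹ • Finsupp.single (a • y) h := by
  simp [translation]

omit [CompleteSpace H] [KreinSpace H] in
theorem IsMultiplier.surjective_translation {α : S → X → ℂ} (hα : IsMultiplier α) (a : S) :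
    Function.Surjective (translation H α a) := by
  rw [← LinearMap.range_eq_top, eq_top_iff]
  intro f _
  induction f using Finsupp.induction_linear with
  | zero => exact Submodule.zero_mem _
  | add f g hf hg => exact Submodule.add_mem _ (hf trivial) (hg trivial)
  | single x h =>
    refine ⟨α a (a⁻¹ • x) • Finsupp.single (a⁻¹ • x) h, ?_⟩
    rw [map_smul, translation_single, smul_inv_smul, smul_inv_smul₀ (hα.ne_zero _ _)]

/-- The weights α⁻¹ cancel the factor conj α(a, x) α(a, y) by which K changes under the action. -/
theorem kernelForm_translation {α : S → X → ℂ} (hα : IsMultiplier α) {K : X → X → H →L[ℂ] H}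
    (hinv : IsInvariantKernel α K) (a : S) (f g : X →₀ H) :
    kernelForm K (translation H α a f) (translation H α a g) = kernelForm K f g := by
  refine kernelForm_ext (B := ((kernelForm K).comp (translation H α a)).compl₂
    (translation H α a)) (fun x y k h => ?_) f g
  have h1 : conj (α a x) ≠ 0 := by simpa using hα.ne_zero a x
  have h2 := hα.ne_zero a y
  simp only [LinearMap.compl₂_apply, LinearMap.comp_apply, translation_single, map_smulₛₗ,
    LinearMap.smul_apply, kernelForm_single_single, hinv.smul_smul, RingHom.id_apply, map_inv₀,
    smul_apply, smul_eq_mul]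
  rw [← indefForm_apply, ← indefForm_apply, map_smul, smul_eq_mul]
  field_simp

omit [CompleteSpace H] [KreinSpace H] in
-- On a point mass at x this is α(a, b x)⁻¹ α(b, x)⁻¹ = σ(a, b) α(ab, x)⁻¹; independence of σ from x
-- makes it one scalar for all f.
theorem translation_translation {α : S → X → ℂ} (hα : IsMultiplier α) (a b : S) (f : X →₀ H) :
    translation H α a (translation H α b f) =
      cocycle (X := X) α a b • translation H α (a * b) f := by
  induction f using Finsupp.induction_linear with
  | zero => simp
  | add f g hf hg => simp [hf, hg]
  | single x h =>
    have h1 := hα.ne_zero (a * b) x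
    rw [translation_single, map_smul, translation_single, translation_single, cocycle_eq hα a b x]
    simp only [smul_smul]
    congr 1
    field_simp

/-- `exists_isUnitary` compares `synthesis V` with its composite with the translation by a; the
operator relating them is U(a), and both identities for U follow from those for translations. -/
theorem IsProjInvKolmogorovDecomposition.of_isKolmogorovDecomposition
    {G : Type*} [NormedAddCommGroup G] [InnerProductSpace ℂ G] [CompleteSpace G] [KreinSpace G]
    {α : S → X → ℂ} (hα : IsMultiplier α) {K : X → X → H →L[ℂ] H} (hK : IsHermitianKernel K)
    (hinv : IsInvariantKernel α K) (hneg : HasFinitelyManyNegativeSquares K) {V : X → H →L[ℂ] G}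
    (hV : IsKolmogorovDecomposition K V) : IsProjInvKolmogorovDecomposition α K V := by
  have hd := (denseRange_synthesis_iff V).2 hV.2
  have hU : ∀ a, ∃ U : G →L[ℂ] G, ∀ f, U (synthesis V f) = synthesis V (translation H α a f) := by
    intro a
    obtain ⟨U, -, hU⟩ := exists_isUnitary hK.conj_kernelForm hneg
      (synthesis V) hd (indef_synthesis hV.1)
      (synthesis V ∘ₗ translation H α a)
      (by rwa [LinearMap.coe_comp, DenseRange, (hα.surjective_translation a).range_comp]) fun f g => by
        rw [LinearMap.comp_apply, LinearMap.comp_apply, indef_synthesis hV.1,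
          kernelForm_translation hα hinv]
    exact ⟨U, hU⟩
  choose U hU using hU
  refine ⟨hV, U, fun a b => ?_, fun a x => ?_⟩
  · refine DFunLike.coe_injective (hd.equalizer (U a ∘L U b).continuous
      (cocycle (X := X) α a b • U (a * b)).continuous (funext fun f => ?_))
    simp [hU, translation_translation hα]
  · ext h
    have h1 := hα.ne_zero a x
    rw [smul_apply, ContinuousLinearMap.comp_apply, ← synthesis_single V x h,
      hU, translation_single, map_smul, synthesis_single, smul_inv_smul₀ h1]

end Actions

end KreinSpace

theorem mainTheorem6 {S : Type w} [Group S] {X : Type u} [MulAction S X]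
    {H : Type v} [NormedAddCommGroup H] [InnerProductSpace ℂ H] [CompleteSpace H] [KreinSpace H]
    (α : S → X → ℂ) (hα : KreinSpace.IsMultiplier α)
    (K : X → X → H →L[ℂ] H) (hK : KreinSpace.IsHermitianKernel K)
    (hinv : KreinSpace.IsInvariantKernel α K)
    (hneg : KreinSpace.HasFinitelyManyNegativeSquares K) :
    (∃ (G : Type (max u v)) (_ : NormedAddCommGroup G) (_ : InnerProductSpace ℂ G)
        (_ : CompleteSpace G) (_ : KreinSpace G) (V : X → H →L[ℂ] G),
        KreinSpace.IsPontryagin G ∧ KreinSpace.IsProjInvKolmogorovDecomposition α K V) ∧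
    (∀ (G₁ : Type w₁) [NormedAddCommGroup G₁] [InnerProductSpace ℂ G₁] [CompleteSpace G₁]
        [KreinSpace G₁] (G₂ : Type w₂) [NormedAddCommGroup G₂] [InnerProductSpace ℂ G₂]
        [CompleteSpace G₂] [KreinSpace G₂] (V₁ : X → H →L[ℂ] G₁) (V₂ : X → H →L[ℂ] G₂),
        KreinSpace.IsProjInvKolmogorovDecomposition α K V₁ →
        KreinSpace.IsProjInvKolmogorovDecomposition α K V₂ →
        ∃ Φ : G₁ →L[ℂ] G₂, KreinSpace.IsUnitary Φ ∧ ∀ x, V₂ x = Φ ∘L V₁ x) := by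
  refine ⟨?_, fun G₁ _ _ _ _ G₂ _ _ _ _ V₁ V₂ h₁ h₂ => h₁.1.exists_isUnitary hK hneg h₂.1⟩
  obtain ⟨G, _, _, _, _, ι, hG, hd, hι⟩ :=
    KreinSpace.exists_pontryagin_completion hK.conj_kernelForm hneg
  obtain ⟨V, hV, -⟩ := KreinSpace.exists_kolmogorovDecomposition ι hd hι
  exact ⟨G, _, _, _, _, V, hG, .of_isKolmogorovDecomposition hα hK hinv hneg hV⟩
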